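/- **Theorem 2 (nominal stability without terminal region).** *Plant and OCP.* Let $\dot x=f(x,u)$ with constraints $x\in\mathbb X\subseteq\mathbb R^n$, $u\in\mathbb U\subseteq\mathbb R^m$, let $\ell:\mathbb X\times\mathbb U\to[0,\infty)$ be a continuous stage cost, $V_{\mathrm f}:\mathbb X\to[0,\infty)$ a terminal penalty, and $T>0$ a prediction horizon. Assume: $f$ is Lipschitz in $x$ on bounded sets, uniformly in $u\in\mathbb U$; for every $R$ there is $c$ with $\|f(x,u)\|\le c(1+\ell(x,u))$ for all $x\in\mathbb X$ with $\|x\|\le R$ and all $u\in\mathbb U$ (both hold if $\mathbb U$ is compact and $f$ is continuous and locally Lipschitz in $x$); and $\ell(x,u)\ge\alpha(\|x\|)$ for some class-$\mathcal K$ function $\alpha$. A pair $(u,x)$ is *admissible* on $[0,s]$ from $z$ if $u$ is measurable, $x(t)=z+\int_0^t f(x,u)\,\mathrm dr$, $u(t)\in\mathbb U$ and $x(t)\in\mathbb X$ on $[0,s]$, and $\int_0^s\ell(x,u)\,\mathrm dt<\infty$. The OCP with terminal penalty $W$, terminal region $\mathbb X_{\mathrm f}$ and initial state $z$ is to minimize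 $\int_0^T\ell(x,u)\,\mathrm dt+W(x(T))$ over the pairs admissible on $[0,T]$ from $z$ with $x(T)\in\mathbb X_{\mathrm f}$. *Algorithm (nominal case: no model error, no disturbance).* The sampling times satisfy $0<\delta\le t_{k+1}-t_k<T$ for some $\delta$. The sensor sends $(x(t_0),t_0)$, and for $k\ge1$ it sends $(x(t_k),t_k)$ if and only if $t_{k+1}\ge t_{u,\max}-\bar\tau_{\mathrm{RTT}}$ or $\|x(t_k)-\hat x(t_k)\|\ge\varepsilon$. Here $t_{u,\max}$ is the latest end of an input trajectory available to the sensor at $t_k$ (those that have arrived at the actuator, and the first one), and $\hat x(t_k)$ is the sensor's prediction from the measurement belonging to the newest such trajectory. Packet $k$ reaches the controller at $t_k+\tau_{\mathrm{UL}}(t_k)$; packet $0$ is the first to be processed, and a packet that arrives after one with a newer time stamp is discarded. With the round-trip time $\tau_{\mathrm{RTT}}(t_k)=\tau_{\mathrm{UL}}(t_k)+\tau_{\mathrm C}+\tau_{\mathrm{DL}}\le\bar\tau_{\mathrm{RTT}}$ (all delays $\ge0$), the controller predicts $\hat x(t_k+\tau_{\mathrm{RTT}}(t_k))$ from $x(t_k)$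 with the inputs in its buffer and takes an optimal input $u^\star$ of the OCP for this initial state. The part of $u^\star$ of length $T_{\mathrm{com}}\le T$ is stored in the buffer and is applied by the actuator from $t_k+\tau_{\mathrm{RTT}}(t_k)$ on, until a newer trajectory arrives. Before $t_0+\tau_{\mathrm{RTT}}(t_0)$ a known $\mathbb U$-valued input is applied. A run is considered as long as the newest arrived trajectory has not expired. The *initial condition* is the state $x_0=x(t_0+\tau_{\mathrm{RTT}}(t_0))$ for which the first OCP is solved. *Terminal ingredients.* Let $\gamma>0$ and suppose that $\mathbb X_{\mathrm f}=\{x\in\mathbb X: V_{\mathrm f}(x)\le\gamma\}$ is closed and connected and contains $0$, that $V_{\mathrm f}$ is $C^1$ near every point of $\mathbb X$, that $V_{\mathrm f}(0)=0$, and that from every point of $\mathbb X_{\mathrm f}$ there is a measurable $\mathbb U$-valued input on $[0,T]$ with a trajectory staying in $\mathbb X_{\mathrm f}$ along which $\frac{\partial V_{\mathrm f}}{\partial x}f(x,u)+\ell(x,u)\le0$ almost everywhere. *Claim.* Let $x_0$ be an initial condition from which the origin can be reached in a finite time $s$ by an admissible pair, where either $s\le T$, or the OCP with terminal region $\mathbb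 X_{\mathrm f}$ has from $x_0$ a feasible pair with $V_{\mathrm f}(x(T))<\gamma$. Then there is $\beta_0<\infty$ such that, for every $\beta\ge\beta_0$ and all timing data as above, the algorithm with the OCP without terminal constraint ($\mathbb X_{\mathrm f}=\mathbb X$) and with terminal penalty $\beta V_{\mathrm f}$ has the following properties for this initial condition: along every run, up to any time $t\ge t_0+\tau_{\mathrm{RTT}}(t_0)$, the OCP is feasible for the state $x(t)$; and on every run that is defined for all times, $\lim_{t\to\infty}\|x(t)\|=0$. -/

import Mathlib

open MeasureTheory Set Filter Topology

noncomputable section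

/-- `x` solves `ẋ = f(x, u)` on `[a, b]` in the sense of Carathéodory: `x` is continuous,
`s ↦ f (x s) (u s)` is integrable and `x t = x a + ∫ₐᵗ f (x s) (u s) ds`. -/
structure IsSolution {n m : ℕ}
    (f : EuclideanSpace ℝ (Fin n) → EuclideanSpace ℝ (Fin m) → EuclideanSpace ℝ (Fin n))
    (u : ℝ → EuclideanSpace ℝ (Fin m)) (x : ℝ → EuclideanSpace ℝ (Fin n)) (a b : ℝ) : Prop where
  continuousOn : ContinuousOn x (Icc a b)
  integrableOn : IntegrableOn (fun s => f (x s) (u s)) (Icc a b)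
  eq_integral : ∀ t ∈ Icc a b, x t = x a + ∫ s in a..t, f (x s) (u s)

/-- The plant `ẋ = f(x, u)` with state constraint set `X`, input constraint set `U`, and the
ingredients of the optimal control problem: stage cost `ℓ`, terminal penalty `Vf`,
prediction horizon `T`. Values of `ℓ` outside `X × U` and of `Vf` away from `X` are irrelevant. -/
structure ControlProblem (n m : ℕ) where
  X : Set (EuclideanSpace ℝ (Fin n))
  U : Set (EuclideanSpace ℝ (Fin m))
  f : EuclideanSpace ℝ (Fin n) → EuclideanSpace ℝ (Fin m) → EuclideanSpace ℝ (Fin n)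
  ℓ : EuclideanSpace ℝ (Fin n) → EuclideanSpace ℝ (Fin m) → ℝ
  Vf : EuclideanSpace ℝ (Fin n) → ℝ
  T : ℝ

namespace ControlProblem

variable {n m : ℕ} (P : ControlProblem n m)

/-- Standing regularity assumptions. `lipschitz` and `growth` hold in particular when `U` is
compact and `f` is continuous and locally Lipschitz in the state; `cost_pos` says that `ℓ(x, u)` is
bounded below by a class-`K` function of `‖x‖`. -/
structure Standing : Prop where
  horizon_pos : 0 < P.T
  lipschitz : ∀ R : ℝ, ∃ L : ℝ, ∀ u ∈ P.U, ∀ x y, ‖x‖ ≤ R → ‖y‖ ≤ R →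
    ‖P.f x u - P.f y u‖ ≤ L * ‖x - y‖
  growth : ∀ R : ℝ, ∃ c : ℝ, ∀ u ∈ P.U, ∀ x ∈ P.X, ‖x‖ ≤ R →
    ‖P.f x u‖ ≤ c * (1 + P.ℓ x u)
  cost_continuous : ContinuousOn (fun p : EuclideanSpace ℝ (Fin n) × EuclideanSpace ℝ (Fin m) =>
    P.ℓ p.1 p.2) (P.X ×ˢ P.U)
  cost_nonneg : ∀ x ∈ P.X, ∀ u ∈ P.U, 0 ≤ P.ℓ x u
  cost_pos : ∀ r : ℝ, 0 < r → ∃ c : ℝ, 0 < c ∧ ∀ x ∈ P.X, r ≤ ‖x‖ → ∀ u ∈ P.U, c ≤ P.ℓ x u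
  penalty_nonneg : ∀ x ∈ P.X, 0 ≤ P.Vf x

/-- `(u, x)` is an admissible input/state pair of duration `s` starting at `z`: it obeys the
dynamics and the constraints and has finite running cost. -/
structure IsAdmissible (z : EuclideanSpace ℝ (Fin n)) (s : ℝ)
    (u : ℝ → EuclideanSpace ℝ (Fin m)) (x : ℝ → EuclideanSpace ℝ (Fin n)) : Prop where
  measurable_input : Measurable u
  solution : IsSolution P.f u x 0 s
  initial : x 0 = z
  input_mem : ∀ t ∈ Icc 0 s, u t ∈ P.U
  state_mem : ∀ t ∈ Icc 0 s, x t ∈ P.X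
  finite_cost : IntegrableOn (fun t => P.ℓ (x t) (u t)) (Icc 0 s)

/-- `(u, x)` satisfies all constraints of the optimal control problem with initial state `z` and
terminal region `Xf`. -/
def IsFeasible (Xf : Set (EuclideanSpace ℝ (Fin n))) (z : EuclideanSpace ℝ (Fin n))
    (u : ℝ → EuclideanSpace ℝ (Fin m)) (x : ℝ → EuclideanSpace ℝ (Fin n)) : Prop :=
  P.IsAdmissible z P.T u x ∧ x P.T ∈ Xf

/-- The objective `∫₀ᵀ ℓ(x, u) dt + W(x(T))` with terminal penalty `W`. -/
def cost (W : EuclideanSpace ℝ (Fin n) → ℝ)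
    (u : ℝ → EuclideanSpace ℝ (Fin m)) (x : ℝ → EuclideanSpace ℝ (Fin n)) : ℝ :=
  (∫ t in (0 : ℝ)..P.T, P.ℓ (x t) (u t)) + W (x P.T)

/-- `(u, x)` solves the optimal control problem with terminal penalty `W`, terminal region `Xf`
and initial state `z`. -/
def IsOptimal (W : EuclideanSpace ℝ (Fin n) → ℝ) (Xf : Set (EuclideanSpace ℝ (Fin n)))
    (z : EuclideanSpace ℝ (Fin n))
    (u : ℝ → EuclideanSpace ℝ (Fin m)) (x : ℝ → EuclideanSpace ℝ (Fin n)) : Prop :=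
  P.IsFeasible Xf z u x ∧ ∀ u' x', P.IsFeasible Xf z u' x' → P.cost W u x ≤ P.cost W u' x'

/-- The origin can be reached from `z` in time `s` by an admissible trajectory. -/
def ReachesOrigin (z : EuclideanSpace ℝ (Fin n)) (s : ℝ) : Prop :=
  ∃ u x, P.IsAdmissible z s u x ∧ x s = 0

/-- The sublevel set `{x ∈ X | Vf x ≤ γ}`. -/
def terminalRegion (γ : ℝ) : Set (EuclideanSpace ℝ (Fin n)) :=
  {x | x ∈ P.X ∧ P.Vf x ≤ γ}

/-- The conditions on the terminal penalty and on the terminal region `Xf` under which the scheme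
with terminal constraint is stabilizing. -/
structure TerminalConditions (Xf : Set (EuclideanSpace ℝ (Fin n))) : Prop where
  penalty_contDiff : ∀ x ∈ P.X, ContDiffAt ℝ 1 P.Vf x
  penalty_zero : P.Vf 0 = 0
  region_subset : Xf ⊆ P.X
  region_closed : IsClosed Xf
  region_connected : IsConnected Xf
  zero_mem : (0 : EuclideanSpace ℝ (Fin n)) ∈ Xf
  decrease : ∀ z ∈ Xf, ∃ (u : ℝ → EuclideanSpace ℝ (Fin m)) (x : ℝ → EuclideanSpace ℝ (Fin n)),
    Measurable u ∧ IsSolution P.f u x 0 P.T ∧ x 0 = z ∧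
    (∀ τ ∈ Icc 0 P.T, u τ ∈ P.U) ∧ (∀ τ ∈ Icc 0 P.T, x τ ∈ Xf) ∧
    ∀ᵐ τ ∂(volume.restrict (Icc 0 P.T)),
      fderiv ℝ P.Vf (x τ) (P.f (x τ) (u τ)) + P.ℓ (x τ) (u τ) ≤ 0

end ControlProblem

/-- Timing data of the networked loop: sampling times `t k`, uplink delay `τUL k` of a packet sent
at `t k`, constant computation and downlink delays `τC`, `τDL`, round-trip bound `τbar`, length
`Tcom` of the communicated input trajectories, event threshold `ε`. -/
structure Network where
  t : ℕ → ℝ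
  τUL : ℕ → ℝ
  τC : ℝ
  τDL : ℝ
  τbar : ℝ
  Tcom : ℝ
  ε : ℝ

namespace Network

variable (N : Network)

/-- Round-trip time of the packet sent at `t k`. -/
def τRTT (k : ℕ) : ℝ := N.τUL k + N.τC + N.τDL

/-- Time at which packet `k` reaches the controller. -/
def received (k : ℕ) : ℝ := N.t k + N.τUL k

/-- Time at which the input trajectory computed from packet `k` reaches the actuator and starts
being applied. -/
def arrival (k : ℕ) : ℝ := N.t k + N.τRTT k

/-- Admissible timing for prediction horizon `T`. -/
structure Valid (T : ℝ) : Prop where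
  sampling : ∃ δ : ℝ, 0 < δ ∧ ∀ i, δ ≤ N.t (i + 1) - N.t i ∧ N.t (i + 1) - N.t i < T
  uplink_nonneg : ∀ k, 0 ≤ N.τUL k
  computation_nonneg : 0 ≤ N.τC
  downlink_nonneg : 0 ≤ N.τDL
  rtt_le : ∀ k, N.τRTT k ≤ N.τbar
  com_le : N.Tcom ≤ T

end Network

/-- All signals occurring in a run of the networked control algorithm. Quantities indexed by `k`
belong to the packet with time stamp `t k`. -/
structure Signals (n m : ℕ) where
  /-- state of the plant -/
  x : ℝ → EuclideanSpace ℝ (Fin n)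
  /-- input applied to the plant -/
  u : ℝ → EuclideanSpace ℝ (Fin m)
  /-- known input used before the first computed trajectory arrives -/
  uInit : ℝ → EuclideanSpace ℝ (Fin m)
  /-- indices of the sampling times at which the sensor sends a packet -/
  sent : Set ℕ
  /-- prediction made by the sensor at sampling time `k` -/
  xSens : ℕ → ℝ → EuclideanSpace ℝ (Fin n)
  /-- input used by the controller for the delay compensation -/
  uBuf : ℕ → ℝ → EuclideanSpace ℝ (Fin m)
  /-- state predicted by the controller in the delay compensation -/
  xPred : ℕ → ℝ → EuclideanSpace ℝ (Fin n)
  /-- input trajectory returned by the optimal control problem, on `[0, T]` -/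
  uOpt : ℕ → ℝ → EuclideanSpace ℝ (Fin m)
  /-- state trajectory returned by the optimal control problem, on `[0, T]` -/
  xOpt : ℕ → ℝ → EuclideanSpace ℝ (Fin n)

namespace Signals

variable {n m : ℕ} (σ : Signals n m) (N : Network)

/-- The controller processes packet `k` iff no packet with a newer time stamp was received
before it. -/
def Accepted (k : ℕ) : Prop :=
  k ∈ σ.sent ∧ ∀ j ∈ σ.sent, k < j → N.received k ≤ N.received j

/-- Among the trajectories with index in `B`, `j` is the newest one that has arrived by time `s`. -/
def ActiveIn (B : Set ℕ) (j : ℕ) (s : ℝ) : Prop :=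
  j ∈ B ∧ N.arrival j ≤ s ∧ ∀ i ∈ B, N.arrival i ≤ s → i ≤ j

/-- `v` is the input prescribed at time `s` by the trajectories with index in `B`: the initial
input before the first arrival, and afterwards the value at `s` of the newest arrived trajectory,
of which only the first part, of length `Tcom`, is available. -/
def Plays (B : Set ℕ) (s : ℝ) (v : EuclideanSpace ℝ (Fin m)) : Prop :=
  (s < N.arrival 0 ∧ v = σ.uInit s) ∨
  (N.arrival 0 ≤ s ∧ ∃ j, ActiveIn N B j s ∧ s ≤ N.arrival j + N.Tcom ∧
    v = σ.uOpt j (s - N.arrival j))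

/-- Trajectory `j` is known to the sensor at sampling time `k`; the first one is known from the
start. -/
def Available (k j : ℕ) : Prop :=
  σ.Accepted N j ∧ j < k ∧ (j = 0 ∨ N.arrival j ≤ N.t k)

/-- The input expiry time `t_{u,max}` as seen by the sensor at sampling time `k` (the latest end of
an available trajectory) is at most `r`. -/
def ExpiryLE (k : ℕ) (r : ℝ) : Prop :=
  ∀ j, σ.Available N k j → N.arrival j + N.Tcom ≤ r

/-- `σ` is a run, up to time `S`, of the networked control algorithm on the nominal plant, where
the controller uses the optimal control problem with terminal penalty `W` and terminal
region `Xf`. -/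
structure IsRunUntil (P : ControlProblem n m) (W : EuclideanSpace ℝ (Fin n) → ℝ)
    (Xf : Set (EuclideanSpace ℝ (Fin n))) (S : ℝ) : Prop where
  /-- the packet with time stamp `t 0` is the first one processed by the controller -/
  init_accepted : σ.Accepted N 0
  uInit_mem : ∀ s, N.t 0 ≤ s → s < N.arrival 0 → σ.uInit s ∈ P.U
  plant : IsSolution P.f σ.u σ.x (N.t 0) S
  actuator : ∀ s, N.t 0 ≤ s → s < S → σ.Plays N {j | σ.Accepted N j} s (σ.u s)
  /-- the sensor predicts from the measurement belonging to the newest available trajectory -/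
  sensor_prediction : ∀ k, 0 < k → N.t k < S → ∀ j, σ.Available N k j →
    (∀ i, σ.Available N k i → i ≤ j) →
    σ.xSens k (N.t j) = σ.x (N.t j) ∧ IsSolution P.f σ.u (σ.xSens k) (N.t j) (N.t k)
  /-- the sensor sends iff the input is about to expire or the prediction error is large -/
  sensor_trigger : ∀ k, 0 < k → N.t k < S →
    (k ∈ σ.sent ↔ σ.ExpiryLE N k (N.t (k + 1) + N.τbar) ∨
      N.ε ≤ ‖σ.x (N.t k) - σ.xSens k (N.t k)‖)
  /-- the input for the delay compensation comes from the buffer of earlier trajectories -/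
  buffer : ∀ k, σ.Accepted N k → N.arrival k < S → ∀ s, N.t k ≤ s → s < N.arrival k →
    σ.Plays N {j | σ.Accepted N j ∧ j < k} s (σ.uBuf k s)
  delay_compensation : ∀ k, σ.Accepted N k → N.arrival k < S →
    σ.xPred k (N.t k) = σ.x (N.t k) ∧
    IsSolution P.f (σ.uBuf k) (σ.xPred k) (N.t k) (N.arrival k)
  controller : ∀ k, σ.Accepted N k → N.arrival k < S →
    P.IsOptimal W Xf (σ.xPred k (N.arrival k)) (σ.uOpt k) (σ.xOpt k)

end Signals

end

/-! Why a large penalty replaces the terminal constraint: let `(u, x)` be a feasible pair from the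
initial condition with `P.Vf (x P.T) < γ`. Its objective `M = ∫ ℓ + β * P.Vf (x P.T)` is at most `β
* γ` once `β` is large. Every optimal pair whose objective is at most `M` then ends in the sublevel
set `P.Vf ≤ γ` by itself, since its running cost is nonnegative.

From there the usual shift argument applies. The unused tail of the optimal pair, prolonged by the
terminal input, is feasible, and its objective is smaller by at least the cost already incurred
(`IsFeasible.exists_shift`). Without model error the delay compensation is exact (`xPred_arrival`),
so between arrivals the plant follows the newest optimal trajectory (`state_eq`), by uniqueness of
solutions. Hence "cost incurred so far plus objective of some feasible pair is at most `M`" passes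
from one accepted arrival to the next (`hasCostLE_of_arrival`, `hasCostLE`). The invariant speaks of
some feasible pair, not of the optimal value, so a minimizer is needed only at arrival times.

Feasibility is part of the invariant. On an infinite run the total stage cost is finite, and a
Barbalat-type argument gives convergence: every excursion of the norm from `ε / 2` to `ε` costs a
fixed positive amount (`tendsto_norm_zero_of_integrableOn_cost`). -/

/-! ### Carathéodory solutions: uniqueness and the chain rule -/

namespace IsSolution

variable {n m : ℕ}
  {f : EuclideanSpace ℝ (Fin n) → EuclideanSpace ℝ (Fin m) → EuclideanSpace ℝ (Fin n)}
  {u v : ℝ → EuclideanSpace ℝ (Fin m)} {x y : ℝ → EuclideanSpace ℝ (Fin n)} {a b c d : ℝ}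

theorem intervalIntegrable (h : IsSolution f u x a b) (hac : a ≤ c) (hcd : c ≤ d) (hdb : d ≤ b) :
    IntervalIntegrable (fun s => f (x s) (u s)) volume c d := by
  rw [intervalIntegrable_iff_integrableOn_Icc_of_le hcd]
  exact h.integrableOn.mono_set (Icc_subset_Icc hac hdb)

theorem sub_eq_integral (h : IsSolution f u x a b) (hac : a ≤ c) (hcd : c ≤ d) (hdb : d ≤ b) :
    x d - x c = ∫ s in c..d, f (x s) (u s) := by
  rw [h.eq_integral d ⟨hac.trans hcd, hdb⟩, h.eq_integral c ⟨hac, hcd.trans hdb⟩,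
    ← intervalIntegral.integral_add_adjacent_intervals
      (h.intervalIntegrable le_rfl hac (hcd.trans hdb)) (h.intervalIntegrable hac hcd hdb)]
  abel

theorem mono (h : IsSolution f u x a b) (hac : a ≤ c) (hdb : d ≤ b) : IsSolution f u x c d where
  continuousOn := h.continuousOn.mono (Icc_subset_Icc hac hdb)
  integrableOn := h.integrableOn.mono_set (Icc_subset_Icc hac hdb)
  eq_integral t ht := by
    rw [← h.sub_eq_integral hac ht.1 (ht.2.trans hdb)]
    abel

/-- The right endpoint is a null set, so the inputs may differ there. This matters because the
applied input switches exactly at an arrival time. -/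
theorem congr (h : IsSolution f u x a b) (hu : EqOn u v (Ico a b)) (hx : EqOn x y (Icc a b)) :
    IsSolution f v y a b := by
  have key : EqOn (fun s => f (x s) (u s)) (fun s => f (y s) (v s)) (Ico a b) := fun s hs => by
    simp only [hu hs, hx (Ico_subset_Icc_self hs)]
  refine ⟨h.continuousOn.congr hx.symm, ?_, fun t ht => ?_⟩
  · rw [integrableOn_Icc_iff_integrableOn_Ico]
    exact (h.integrableOn.mono_set Ico_subset_Icc_self).congr_fun key measurableSet_Ico
  · rw [← hx ht, ← hx ⟨le_rfl, ht.1.trans ht.2⟩, h.eq_integral t ht]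
    congr 1
    rw [intervalIntegral.integral_of_le ht.1, intervalIntegral.integral_of_le ht.1,
      integral_Ioc_eq_integral_Ioo, integral_Ioc_eq_integral_Ioo]
    exact setIntegral_congr_fun measurableSet_Ioo
      fun s hs => key ⟨hs.1.le, hs.2.trans_le ht.2⟩

theorem comp_add_right (h : IsSolution f u x a b) (c : ℝ) :
    IsSolution f (fun t => u (t + c)) (fun t => x (t + c)) (a - c) (b - c) where
  continuousOn := h.continuousOn.comp (by fun_prop) fun t ht =>
    ⟨by linarith [ht.1], by linarith [ht.2]⟩
  integrableOn := by
    rcases le_or_gt a b with hab | hab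
    · rw [← intervalIntegrable_iff_integrableOn_Icc_of_le (by linarith)]
      exact (h.intervalIntegrable le_rfl hab le_rfl).comp_add_right c
    · rw [Icc_eq_empty (by linarith)]
      exact integrableOn_empty
  eq_integral t ht := by
    have h1 : t + c ∈ Icc a b := ⟨by linarith [ht.1], by linarith [ht.2]⟩
    rw [intervalIntegral.integral_comp_add_right (fun s => f (x s) (u s)) c, sub_add_cancel,
      ← h.eq_integral _ h1]

theorem trans (h₁ : IsSolution f u x a b) (h₂ : IsSolution f u x b c) (hab : a ≤ b) (hbc : b ≤ c) :
    IsSolution f u x a c where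
  continuousOn := by
    rw [← Icc_union_Icc_eq_Icc hab hbc]
    exact h₁.continuousOn.union_of_isClosed h₂.continuousOn isClosed_Icc isClosed_Icc
  integrableOn := by
    rw [← Icc_union_Icc_eq_Icc hab hbc]
    exact h₁.integrableOn.union h₂.integrableOn
  eq_integral t ht := by
    rcases le_total t b with htb | htb
    · exact h₁.eq_integral t ⟨ht.1, htb⟩
    · rw [h₂.eq_integral t ⟨htb, ht.2⟩, h₁.eq_integral b ⟨hab, le_rfl⟩, add_assoc,
        intervalIntegral.integral_add_adjacent_intervals
          (h₁.intervalIntegrable le_rfl hab le_rfl) (h₂.intervalIntegrable le_rfl htb ht.2)]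

/-- Two solutions with the same initial value and the same input, whose values lie in a set `U`
on which `f` is locally Lipschitz in the state uniformly in the input, coincide. -/
theorem eqOn {U : Set (EuclideanSpace ℝ (Fin m))}
    (hf : ∀ R : ℝ, ∃ L : ℝ, ∀ u ∈ U, ∀ x y, ‖x‖ ≤ R → ‖y‖ ≤ R → ‖f x u - f y u‖ ≤ L * ‖x - y‖)
    (hx : IsSolution f u x a b) (hy : IsSolution f u y a b) (h0 : x a = y a)
    (hu : ∀ s ∈ Ico a b, u s ∈ U) : EqOn x y (Icc a b) := by
  intro t₀ ht₀
  have hab : a ≤ b := ht₀.1.trans ht₀.2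
  obtain ⟨R₁, hR₁⟩ := isCompact_Icc.exists_bound_of_continuousOn hx.continuousOn
  obtain ⟨R₂, hR₂⟩ := isCompact_Icc.exists_bound_of_continuousOn hy.continuousOn
  obtain ⟨L, hL⟩ := hf (max R₁ R₂)
  -- Extending the distance continuously to the whole line makes its primitive differentiable
  -- everywhere. Grönwall's inequality is then applied to this primitive, which vanishes at `a`.
  let φ : ℝ → ℝ := IccExtend hab (domRestrict (Icc a b) fun t => ‖x t - y t‖)
  have hφc : Continuous φ :=
    (continuousOn_iff_continuous_domRestrict.1 (hx.continuousOn.sub hy.continuousOn).norm).Icc_extend'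
  have hφ : ∀ t ∈ Icc a b, φ t = ‖x t - y t‖ := fun t ht => IccExtend_of_mem hab _ ht
  have hle : ∀ t ∈ Icc a b, φ t ≤ L * ∫ s in a..t, φ s := by
    intro t ht
    rw [hφ t ht, hx.eq_integral t ht, hy.eq_integral t ht, h0, add_sub_add_left_eq_sub,
      ← intervalIntegral.integral_sub (hx.intervalIntegrable le_rfl ht.1 ht.2)
        (hy.intervalIntegrable le_rfl ht.1 ht.2), ← intervalIntegral.integral_const_mul]
    refine intervalIntegral.norm_integral_le_of_norm_le ht.1 ?_
      (hφc.intervalIntegrable _ _ |>.const_mul L)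
    have hne : ∀ᵐ s : ℝ, s ≠ t := by simp [ae_iff, measure_singleton]
    filter_upwards [hne] with s hst hs
    have hs' : s ∈ Icc a b := ⟨hs.1.le, hs.2.trans ht.2⟩
    rw [hφ s hs']
    exact hL _ (hu s ⟨hs.1.le, (lt_of_le_of_ne hs.2 hst).trans_le ht.2⟩) _ _
      ((hR₁ s hs').trans (le_max_left _ _)) ((hR₂ s hs').trans (le_max_right _ _))
  have hder : ∀ t, HasDerivAt (fun t => ∫ s in a..t, φ s) (φ t) t := fun t =>
    hφc.integral_hasStrictDerivAt a t |>.hasDerivAt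
  have hzero : ∫ s in a..t₀, φ s = 0 :=
    eq_zero_of_abs_deriv_le_mul_abs_self_of_eq_zero_right (K := L)
      (fun t _ => (hder t).continuousAt.continuousWithinAt)
      (fun t _ => (hder t).hasDerivWithinAt) (by simp)
      (fun t ht => by
        have ht' := Ico_subset_Icc_self ht
        have hnn : ∀ s ∈ Icc a t, 0 ≤ φ s := fun s hs => by
          rw [hφ s ⟨hs.1, hs.2.trans ht'.2⟩]; exact norm_nonneg _
        rw [Real.norm_of_nonneg (intervalIntegral.integral_nonneg ht.1 hnn),
          Real.norm_of_nonneg (hnn t ⟨ht.1, le_rfl⟩)]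
        exact hle t ht') t₀ ht₀
  have h := hle t₀ ht₀
  rw [hzero, mul_zero, hφ t₀ ht₀] at h
  exact sub_eq_zero.1 (norm_le_zero_iff.1 h)

/-- Along a solution, a function `V` that is `C¹` at the points of the solution satisfies the
chain rule in integrated form. -/
theorem integral_fderiv_comp {V : EuclideanSpace ℝ (Fin n) → ℝ} (h : IsSolution f u x a b)
    (hV : ∀ t ∈ Icc a b, ContDiffAt ℝ 1 V (x t)) (hab : a ≤ b) :
    IntervalIntegrable (fun t => fderiv ℝ V (x t) (f (x t) (u t))) volume a b ∧
      ∫ t in a..b, fderiv ℝ V (x t) (f (x t) (u t)) = V (x b) - V (x a) := by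
  have hI := h.intervalIntegrable le_rfl hab le_rfl
  have hlip : LocallyLipschitzOn (x '' Icc a b) V := by
    rintro _ ⟨t, ht, rfl⟩
    obtain ⟨K, s, hs, hK⟩ := (hV t ht).exists_lipschitzOnWith
    exact ⟨K, s, mem_nhdsWithin_of_mem_nhds hs, hK⟩
  obtain ⟨K, hK⟩ := hlip.exists_lipschitzOnWith_of_compact
    (isCompact_Icc.image_of_continuousOn h.continuousOn)
  have hcont : ContinuousOn (fun t => fderiv ℝ V (x t)) (Icc a b) := fun t ht =>
    ((hV t ht).continuousAt_fderiv (by simp)).comp_continuousWithinAt (h.continuousOn t ht)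
  have hg := hI.norm.absolutelyContinuousOnInterval_intervalIntegral (c := a) (by simp)
  -- The velocity is only integrable, so `x` need not be Lipschitz. But `V` is Lipschitz on the
  -- compact image of `x`, and increments of `x` are dominated by those of the primitive of `‖f‖`,
  -- which is absolutely continuous.
  have hAC : AbsolutelyContinuousOnInterval (fun t => V (x t)) a b := by
    have hd : ∀ s ∈ Icc a b, ∀ t ∈ Icc a b, dist (V (x s)) (V (x t)) ≤
        K * dist (∫ r in a..s, ‖f (x r) (u r)‖) (∫ r in a..t, ‖f (x r) (u r)‖) := by
      intro s hs t ht
      wlog hst : s ≤ t generalizing s t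
      · rw [dist_comm (V (x s)), dist_comm (∫ r in a..s, _)]
        exact this t ht s hs (le_of_not_ge hst)
      refine (hK.dist_le_mul _ ⟨s, hs, rfl⟩ _ ⟨t, ht, rfl⟩).trans ?_
      gcongr
      rw [dist_comm, dist_eq_norm, h.sub_eq_integral hs.1 hst ht.2, dist_comm, Real.dist_eq,
        intervalIntegral.integral_interval_sub_left
          (h.intervalIntegrable le_rfl ht.1 ht.2).norm (h.intervalIntegrable le_rfl hs.1 hs.2).norm]
      exact (intervalIntegral.norm_integral_le_integral_norm hst).trans (le_abs_self _)
    rw [absolutelyContinuousOnInterval_iff] at hg ⊢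
    intro ε hε
    obtain ⟨δ, hδ, hδε⟩ := hg (ε / (K + 1)) (by positivity)
    refine ⟨δ, hδ, fun E hE hlen => ?_⟩
    have h1 := hδε E hE hlen
    rw [lt_div_iff₀ (by positivity)] at h1
    refine lt_of_le_of_lt ?_ h1
    calc _ ≤ ∑ i ∈ Finset.range E.1, K * dist (∫ r in a..(E.2 i).1, ‖f (x r) (u r)‖)
            (∫ r in a..(E.2 i).2, ‖f (x r) (u r)‖) := by
          refine Finset.sum_le_sum fun i hi => ?_
          have h2 := hE.1 i hi
          rw [uIcc_of_le hab] at h2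
          exact hd _ h2.1 _ h2.2
      _ ≤ _ := by
          rw [← Finset.mul_sum, mul_comm]
          gcongr
          linarith
  have hInt : IntegrableOn (fun t => fderiv ℝ V (x t) (f (x t) (u t))) (Icc a b) := by
    obtain ⟨C, hC⟩ := isCompact_Icc.exists_bound_of_continuousOn hcont
    refine Integrable.mono' (h.integrableOn.norm.const_mul C)
      ((ContinuousLinearMap.id ℝ _).aestronglyMeasurable_comp₂
        (hcont.aestronglyMeasurable measurableSet_Icc) h.integrableOn.1) ?_
    filter_upwards [ae_restrict_mem measurableSet_Icc] with t ht
    exact (ContinuousLinearMap.le_opNorm _ _).trans (by gcongr; exact hC t ht)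
  refine ⟨(intervalIntegrable_iff_integrableOn_Icc_of_le hab).2 hInt, ?_⟩
  rw [← hAC.integral_deriv_eq_sub]
  refine intervalIntegral.integral_congr_ae ?_
  have hne : ∀ᵐ s : ℝ, s ≠ b := by simp [ae_iff, measure_singleton]
  filter_upwards [hne, hI.ae_hasDerivAt_integral] with t htb hd ht
  rw [uIoc_of_le hab] at ht
  have htm : t ∈ Ioo a b := ⟨ht.1, lt_of_le_of_ne ht.2 htb⟩
  have ht' := Ioo_subset_Icc_self htm
  have hxd : HasDerivAt x (f (x t) (u t)) t := by
    refine ((hd (by rwa [uIcc_of_le hab]) a (by simp)).const_add (x a)).congr_of_eventuallyEq ?_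
    filter_upwards [Icc_mem_nhds htm.1 htm.2] with s hs using h.eq_integral s hs
  exact (((hV t ht').differentiableAt (by simp)).hasFDerivAt.comp_hasDerivAt t hxd).deriv.symm

end IsSolution

/-! ### Admissible pairs, concatenation and the shifted pair -/

namespace ControlProblem

variable {n m : ℕ} {P : ControlProblem n m}

/-- Since `ℓ` is continuous only on `X × U`, measurability is obtained on the subtype through which
the pair `(x, u)` factors. -/
theorem Standing.aestronglyMeasurable_cost (hP : P.Standing)
    {u : ℝ → EuclideanSpace ℝ (Fin m)} {x : ℝ → EuclideanSpace ℝ (Fin n)} {a b : ℝ}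
    (hx : ContinuousOn x (Icc a b)) (hu : Measurable u)
    (hxX : ∀ t ∈ Icc a b, x t ∈ P.X) (huU : ∀ t ∈ Icc a b, u t ∈ P.U) :
    AEStronglyMeasurable (fun t => P.ℓ (x t) (u t)) (volume.restrict (Icc a b)) := by
  refine (aemeasurable_restrict_of_measurable_subtype measurableSet_Icc ?_).aestronglyMeasurable
  have hpair : Measurable fun t : Icc a b =>
      (⟨(x t, u t), hxX t t.2, huU t t.2⟩ : ↥(P.X ×ˢ P.U)) :=
    ((continuousOn_iff_continuous_domRestrict.1 hx).measurable.prodMk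
      (hu.comp measurable_subtype_coe)).subtype_mk
  exact (continuousOn_iff_continuous_domRestrict.1 hP.cost_continuous).measurable.comp hpair

namespace IsAdmissible

variable {z : EuclideanSpace ℝ (Fin n)} {s d : ℝ}
  {u u₁ u₂ : ℝ → EuclideanSpace ℝ (Fin m)} {x x₁ x₂ : ℝ → EuclideanSpace ℝ (Fin n)}

theorem take (h : P.IsAdmissible z s u x) (hd : d ≤ s) : P.IsAdmissible z d u x where
  measurable_input := h.measurable_input
  solution := h.solution.mono le_rfl hd
  initial := h.initial
  input_mem t ht := h.input_mem t ⟨ht.1, ht.2.trans hd⟩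
  state_mem t ht := h.state_mem t ⟨ht.1, ht.2.trans hd⟩
  finite_cost := h.finite_cost.mono_set (Icc_subset_Icc_right hd)

theorem intervalIntegrable_cost (h : P.IsAdmissible z s u x) {a b : ℝ} (ha : 0 ≤ a) (hab : a ≤ b)
    (hb : b ≤ s) : IntervalIntegrable (fun t => P.ℓ (x t) (u t)) volume a b :=
  (intervalIntegrable_iff_integrableOn_Icc_of_le hab).2
    (h.finite_cost.mono_set (Icc_subset_Icc ha hb))

theorem integral_cost_nonneg (h : P.IsAdmissible z s u x) (hP : P.Standing) {a b : ℝ}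
    (ha : 0 ≤ a) (hab : a ≤ b) (hb : b ≤ s) : 0 ≤ ∫ t in a..b, P.ℓ (x t) (u t) :=
  intervalIntegral.integral_nonneg hab fun t ht =>
    have ht' : t ∈ Icc 0 s := ⟨ha.trans ht.1, ht.2.trans hb⟩
    hP.cost_nonneg _ (h.state_mem t ht') _ (h.input_mem t ht')

theorem drop (h : P.IsAdmissible z s u x) (hd : 0 ≤ d) (hds : d ≤ s) :
    P.IsAdmissible (x d) (s - d) (fun t => u (t + d)) (fun t => x (t + d)) where
  measurable_input := h.measurable_input.comp (measurable_id.add_const d)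
  solution := by
    simpa using (h.solution.mono hd le_rfl).comp_add_right d
  initial := by simp
  input_mem t ht := h.input_mem _ ⟨by linarith [ht.1], by linarith [ht.2]⟩
  state_mem t ht := h.state_mem _ ⟨by linarith [ht.1], by linarith [ht.2]⟩
  finite_cost := by
    rw [← intervalIntegrable_iff_integrableOn_Icc_of_le (by linarith)]
    simpa using (h.intervalIntegrable_cost hd hds le_rfl).comp_add_right d

/-- Concatenation at time `a`: the states match there by `h₂.initial`, and the value of the input at
the junction affects no integral. -/
theorem exists_trans {a b : ℝ} (h₁ : P.IsAdmissible z a u₁ x₁)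
    (h₂ : P.IsAdmissible (x₁ a) b u₂ x₂) (ha : 0 ≤ a) (hb : 0 ≤ b) :
    ∃ u x, P.IsAdmissible z (a + b) u x ∧ x (a + b) = x₂ b ∧
      ∫ t in (0 : ℝ)..(a + b), P.ℓ (x t) (u t) =
        (∫ t in (0 : ℝ)..a, P.ℓ (x₁ t) (u₁ t)) + ∫ t in (0 : ℝ)..b, P.ℓ (x₂ t) (u₂ t) := by
  let u : ℝ → EuclideanSpace ℝ (Fin m) := fun t => if t < a then u₁ t else u₂ (t - a)
  let x : ℝ → EuclideanSpace ℝ (Fin n) := fun t => if t < a then x₁ t else x₂ (t - a)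
  have hu₁ : ∀ t, t < a → u t = u₁ t := fun t ht => if_pos ht
  have hu₂ : ∀ t, a ≤ t → u t = u₂ (t - a) := fun t ht => if_neg ht.not_gt
  have hx₂ : ∀ t, a ≤ t → x t = x₂ (t - a) := fun t ht => if_neg ht.not_gt
  have hx₁ : ∀ t, t ≤ a → x t = x₁ t := fun t ht => by
    rcases ht.lt_or_eq with ht | rfl
    · exact if_pos ht
    · rw [hx₂ t le_rfl, sub_self, h₂.initial]
  have hab : a ≤ a + b := by linarith
  have hsol₂ := h₂.solution.comp_add_right (-a)
  simp only [sub_neg_eq_add, zero_add, ← sub_eq_add_neg] at hsol₂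
  rw [add_comm b a] at hsol₂
  have hcost₁ : ∀ t ∈ Ioo 0 a, P.ℓ (x₁ t) (u₁ t) = P.ℓ (x t) (u t) := fun t ht => by
    rw [hu₁ t ht.2, hx₁ t ht.2.le]
  have hcost₂ : ∀ t ∈ Ioo a (a + b), P.ℓ (x₂ (t - a)) (u₂ (t - a)) = P.ℓ (x t) (u t) :=
    fun t ht => by rw [hu₂ t ht.1.le, hx₂ t ht.1.le]
  have hint₁ : IntervalIntegrable (fun t => P.ℓ (x t) (u t)) volume 0 a := by
    rw [intervalIntegrable_iff_integrableOn_Ioo_of_le ha]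
    exact (h₁.finite_cost.mono_set Ioo_subset_Icc_self).congr_fun hcost₁ measurableSet_Ioo
  have hint₂ : IntervalIntegrable (fun t => P.ℓ (x t) (u t)) volume a (a + b) := by
    have h := (h₂.intervalIntegrable_cost le_rfl hb le_rfl).comp_sub_right a
    rw [zero_add, add_comm b a, intervalIntegrable_iff_integrableOn_Ioo_of_le hab] at h
    rw [intervalIntegrable_iff_integrableOn_Ioo_of_le hab]
    exact h.congr_fun hcost₂ measurableSet_Ioo
  refine ⟨u, x, ⟨?_, ?_, ?_, ?_, ?_, ?_⟩, ?_, ?_⟩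
  · exact Measurable.ite measurableSet_Iio h₁.measurable_input
      (h₂.measurable_input.comp (measurable_id.sub_const a))
  · exact (h₁.solution.congr (fun t ht => (hu₁ t ht.2).symm) fun t ht => (hx₁ t ht.2).symm).trans
      (hsol₂.congr (fun t ht => (hu₂ t ht.1).symm) fun t ht => (hx₂ t ht.1).symm) ha hab
  · rw [hx₁ 0 ha, h₁.initial]
  · intro t ht
    rcases lt_or_ge t a with hta | hta
    · rw [hu₁ t hta]
      exact h₁.input_mem t ⟨ht.1, hta.le⟩
    · rw [hu₂ t hta]
      exact h₂.input_mem _ ⟨by linarith, by linarith [ht.2]⟩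
  · intro t ht
    rcases lt_or_ge t a with hta | hta
    · rw [hx₁ t hta.le]
      exact h₁.state_mem t ⟨ht.1, hta.le⟩
    · rw [hx₂ t hta]
      exact h₂.state_mem _ ⟨by linarith, by linarith [ht.2]⟩
  · exact (intervalIntegrable_iff_integrableOn_Icc_of_le (by linarith)).1 (hint₁.trans hint₂)
  · rw [hx₂ _ hab, add_sub_cancel_left]
  · rw [← intervalIntegral.integral_add_adjacent_intervals hint₁ hint₂]
    congr 1
    · rw [intervalIntegral.integral_of_le ha, intervalIntegral.integral_of_le ha,
        integral_Ioc_eq_integral_Ioo, integral_Ioc_eq_integral_Ioo]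
      exact setIntegral_congr_fun measurableSet_Ioo fun t ht => (hcost₁ t ht).symm
    · have h := intervalIntegral.integral_comp_sub_right (a := a) (b := a + b)
        (fun t => P.ℓ (x₂ t) (u₂ t)) a
      rw [sub_self, add_sub_cancel_left] at h
      rw [← h, intervalIntegral.integral_of_le hab, intervalIntegral.integral_of_le hab,
        integral_Ioc_eq_integral_Ioo, integral_Ioc_eq_integral_Ioo]
      exact setIntegral_congr_fun measurableSet_Ioo fun t ht => (hcost₂ t ht).symm

end IsAdmissible

/-- From every point of the terminal region there is an admissible pair along which the terminal
penalty pays for the running cost. -/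
theorem TerminalConditions.exists_isAdmissible {Xf : Set (EuclideanSpace ℝ (Fin n))}
    (hterm : P.TerminalConditions Xf) (hP : P.Standing) {z : EuclideanSpace ℝ (Fin n)}
    (hz : z ∈ Xf) :
    ∃ u x, P.IsAdmissible z P.T u x ∧ (∀ t ∈ Icc 0 P.T, x t ∈ Xf) ∧
      ∀ t ∈ Icc 0 P.T, P.Vf (x t) + ∫ r in (0 : ℝ)..t, P.ℓ (x r) (u r) ≤ P.Vf z := by
  obtain ⟨u, x, hu, hsol, hx0, huU, hxf, hdec⟩ := hterm.decrease z hz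
  have hxX : ∀ t ∈ Icc 0 P.T, x t ∈ P.X := fun t ht => hterm.region_subset (hxf t ht)
  have hchain : ∀ t ∈ Icc 0 P.T, _ := fun t ht =>
    (hsol.mono le_rfl ht.2).integral_fderiv_comp (V := P.Vf)
      (fun r hr => hterm.penalty_contDiff _ (hxX r ⟨hr.1, hr.2.trans ht.2⟩)) ht.1
  -- Finite cost comes from the decrease condition: almost everywhere `0 ≤ ℓ ≤ -V̇`, and `V̇` is
  -- integrable by the chain rule.
  have hcost : IntegrableOn (fun t => P.ℓ (x t) (u t)) (Icc 0 P.T) := by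
    have h := (hchain P.T ⟨hP.horizon_pos.le, le_rfl⟩).1
    rw [intervalIntegrable_iff_integrableOn_Icc_of_le hP.horizon_pos.le] at h
    refine Integrable.mono' h.neg
      (hP.aestronglyMeasurable_cost hsol.continuousOn hu hxX huU) ?_
    filter_upwards [hdec, ae_restrict_mem measurableSet_Icc] with t ht htm
    rw [Real.norm_of_nonneg (hP.cost_nonneg _ (hxX t htm) _ (huU t htm))]
    simp only [Pi.neg_apply]
    linarith
  have hadm : P.IsAdmissible z P.T u x := ⟨hu, hsol, hx0, huU, hxX, hcost⟩
  refine ⟨u, x, hadm, hxf, fun t ht => ?_⟩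
  obtain ⟨hi, he⟩ := hchain t ht
  have hle : ∫ r in (0 : ℝ)..t, P.ℓ (x r) (u r) ≤
      ∫ r in (0 : ℝ)..t, -fderiv ℝ P.Vf (x r) (P.f (x r) (u r)) := by
    refine intervalIntegral.integral_mono_ae_restrict ht.1
      (hadm.intervalIntegrable_cost le_rfl ht.1 ht.2) hi.neg ?_
    filter_upwards [ae_restrict_of_ae_restrict_of_subset (Icc_subset_Icc_right ht.2) hdec] with r hr
    linarith
  rw [intervalIntegral.integral_neg, he, hx0] at hle
  linarith

/-- The shifted pair: when a feasible pair ending in the terminal region has been applied for a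
time `d`, its remainder can be prolonged to a feasible pair, and the objective decreases by at
least the cost incurred. -/
theorem IsFeasible.exists_shift {Xf : Set (EuclideanSpace ℝ (Fin n))}
    (hterm : P.TerminalConditions Xf) (hP : P.Standing) {z : EuclideanSpace ℝ (Fin n)}
    {u : ℝ → EuclideanSpace ℝ (Fin m)} {x : ℝ → EuclideanSpace ℝ (Fin n)} {d β : ℝ}
    (h : P.IsFeasible Xf z u x) (hβ : 1 ≤ β) (hd : d ∈ Icc 0 P.T) :
    ∃ u' x', P.IsFeasible P.X (x d) u' x' ∧
      P.cost (fun x => β * P.Vf x) u' x' + ∫ t in (0 : ℝ)..d, P.ℓ (x t) (u t) ≤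
        P.cost (fun x => β * P.Vf x) u x := by
  obtain ⟨hadm, hxT⟩ := h
  obtain ⟨v, y, hy, -, hdec⟩ := hterm.exists_isAdmissible hP hxT
  have hrest := hadm.drop hd.1 hd.2
  have hy' : P.IsAdmissible (x (P.T - d + d)) d v y := by
    rw [sub_add_cancel]
    exact hy.take hd.2
  obtain ⟨u', x', hadm', hend, hcost⟩ := hrest.exists_trans hy' (by linarith [hd.2]) hd.1
  rw [sub_add_cancel] at hadm' hend hcost
  refine ⟨u', x', ⟨hadm', hadm'.state_mem _ ⟨hP.horizon_pos.le, le_rfl⟩⟩, ?_⟩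
  have hcv := intervalIntegral.integral_comp_add_right (a := 0) (b := P.T - d)
    (fun t => P.ℓ (x t) (u t)) d
  rw [zero_add, sub_add_cancel] at hcv
  have hsplit := intervalIntegral.integral_add_adjacent_intervals
    (hadm.intervalIntegrable_cost le_rfl hd.1 hd.2) (hadm.intervalIntegrable_cost hd.1 hd.2 le_rfl)
  have hnn := hy.integral_cost_nonneg hP le_rfl hd.1 hd.2
  have hd' := hdec d hd
  simp only [cost]
  rw [hcost, hend, hcv, ← hsplit]
  -- The prolongation changes the objective by `∫ ℓ(y, v) + β * (Vf (y d) - Vf (x T))`, which is at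
  -- most `(1 - β) * ∫ ℓ(y, v)`. This is nonpositive because `1 ≤ β`.
  nlinarith

/-- A state from which the origin is reached within the horizon has a feasible pair that ends
with vanishing terminal penalty. -/
theorem ReachesOrigin.exists_isFeasible {γ : ℝ}
    (hterm : P.TerminalConditions (P.terminalRegion γ)) (hP : P.Standing)
    {z : EuclideanSpace ℝ (Fin n)} {s : ℝ} (h : P.ReachesOrigin z s) (hs : 0 ≤ s) (hsT : s ≤ P.T) :
    ∃ u x, P.IsFeasible (P.terminalRegion γ) z u x ∧ P.Vf (x P.T) ≤ 0 := by
  obtain ⟨u₁, x₁, h₁, hx₁⟩ := h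
  obtain ⟨v, y, hy, hyf, hdec⟩ := hterm.exists_isAdmissible hP hterm.zero_mem
  have hrest : P.T - s ∈ Icc 0 P.T := ⟨by linarith, by linarith⟩
  rw [← hx₁] at hy
  obtain ⟨u, x, hadm, hend, -⟩ := h₁.exists_trans (hy.take hrest.2) hs hrest.1
  rw [add_sub_cancel] at hadm hend
  refine ⟨u, x, ⟨hadm, hend ▸ hyf _ hrest⟩, ?_⟩
  have hnn := hy.integral_cost_nonneg hP le_rfl hrest.1 hrest.2
  have h := hdec _ hrest
  rw [hterm.penalty_zero] at h
  rw [hend]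
  linarith

end ControlProblem

/-! ### Convergence from finite total cost -/

/-- A curve whose velocity and position are controlled by an integrable cost tends to zero. -/
theorem tendsto_norm_zero_of_integrableOn_cost {E : Type*} [NormedAddCommGroup E] [NormedSpace ℝ E]
    {x F : ℝ → E} {g : ℝ → ℝ} {a : ℝ} (hx : ContinuousOn x (Ici a))
    (hF : ∀ s t, a ≤ s → s ≤ t → x t - x s = ∫ r in s..t, F r)
    (hg : IntegrableOn g (Ioi a)) (hg0 : ∀ t, a ≤ t → 0 ≤ g t)
    (hgrowth : ∀ R : ℝ, ∃ c : ℝ, ∀ t, a ≤ t → ‖x t‖ ≤ R → ‖F t‖ ≤ c * (1 + g t))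
    (hpos : ∀ r : ℝ, 0 < r → ∃ c : ℝ, 0 < c ∧ ∀ t, a ≤ t → r ≤ ‖x t‖ → c ≤ g t) :
    Tendsto (fun t => ‖x t‖) atTop (𝓝 0) := by
  refine Metric.tendsto_atTop.2 fun ε hε => ?_
  obtain ⟨c₁, hc₁, hpos⟩ := hpos (ε / 2) (by positivity)
  obtain ⟨c, hgrowth⟩ := hgrowth ε
  -- Where `ε / 2 ≤ ‖x‖ ≤ ε`, the cost is at least `c₁`, so `1 ≤ g / c₁` and the speed bound `c * (1
  -- + g)` is absorbed into `K * g`. With `η` below, a stretch of cost less than `η` moves `x` by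
  -- less than `ε / 2`.
  set K : ℝ := |c| * (1 / c₁ + 1) with hK
  have hK0 : 0 ≤ K := by positivity
  set η : ℝ := ε / 2 / (K + 1) with hη
  have hη0 : 0 < η := by positivity
  have hint : ∀ s t, a ≤ s → s ≤ t → IntervalIntegrable g volume s t := fun s t has hst =>
    (intervalIntegrable_iff_integrableOn_Ioc_of_le hst).2
      (hg.mono_set fun r hr => has.trans_lt hr.1)
  obtain ⟨A, haA, hA⟩ : ∃ A, a ≤ A ∧ ∀ s t, A ≤ s → s ≤ t → ∫ r in s..t, g r < η := by
    obtain ⟨B, hB⟩ := Metric.tendsto_atTop.1 (intervalIntegral_tendsto_integral_Ioi a hg tendsto_id)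
      (η / 2) (by positivity)
    refine ⟨max a B, le_max_left _ _, fun s t hs hst => ?_⟩
    have has := (le_max_left a B).trans hs
    have h1 := hB s ((le_max_right _ _).trans hs)
    have h2 := hB t ((le_max_right _ _).trans (hs.trans hst))
    have h3 := intervalIntegral.integral_add_adjacent_intervals (hint a s le_rfl has)
      (hint s t has hst)
    rw [Real.dist_eq, abs_lt] at h1 h2
    simp only [id] at h1 h2
    linarith [h1.1, h2.2]
  -- If the norm stayed above `ε / 2` after `A`, a stretch of length `η / c₁` would already cost
  -- `η`.
  obtain ⟨t₁, hAt₁, ht₁⟩ : ∃ t₁, A ≤ t₁ ∧ ‖x t₁‖ < ε / 2 := by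
    by_contra! hcon
    have hle : A ≤ A + η / c₁ := by linarith [div_pos hη0 hc₁]
    have h := intervalIntegral.integral_mono_on hle (f := fun _ => c₁)
      intervalIntegrable_const (hint _ _ haA hle)
      fun t ht => hpos t (haA.trans ht.1) (hcon t ht.1)
    rw [intervalIntegral.integral_const, add_sub_cancel_left, smul_eq_mul,
      div_mul_cancel₀ _ hc₁.ne'] at h
    exact absurd (hA A _ le_rfl hle) h.not_gt
  refine ⟨t₁, fun t ht => ?_⟩
  rw [dist_zero_right, norm_norm]
  by_contra! hcon
  have hat₁ := haA.trans hAt₁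
  have hcont : ∀ q, ContinuousOn (fun s => ‖x s‖) (Icc t₁ q) := fun q =>
    hx.norm.mono fun s hs => hat₁.trans hs.1
  -- `q` is the first time after `t₁` with norm at least `ε`, and `p` the last time before it with
  -- norm at most `ε / 2`. Between them both bounds behind `K` hold.
  obtain ⟨q, ⟨⟨hq₁, -⟩, hqε⟩, hqmin⟩ :=
    (isCompact_Icc.of_isClosed_subset ((hcont t).preimage_isClosed_of_isClosed isClosed_Icc
      (isClosed_Ici (a := ε))) inter_subset_left).exists_isLeast ⟨t, ⟨ht, le_rfl⟩, hcon⟩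
  obtain ⟨p, ⟨⟨hp₁, hpq⟩, hpε⟩, hpmax⟩ :=
    (isCompact_Icc.of_isClosed_subset ((hcont q).preimage_isClosed_of_isClosed isClosed_Icc
      (isClosed_Iic (a := ε / 2))) inter_subset_left).exists_isGreatest
      ⟨t₁, ⟨le_rfl, hq₁⟩, ht₁.le⟩
  have hqt : q ≤ t := hqmin ⟨⟨ht, le_rfl⟩, hcon⟩
  have hbound : ∀ s ∈ Ioo p q, ‖F s‖ ≤ K * g s := by
    intro s hs
    have has : a ≤ s := hat₁.trans (hp₁.trans hs.1.le)
    have hlow : ε / 2 ≤ ‖x s‖ := by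
      by_contra! hlt
      exact absurd (hpmax ⟨⟨hp₁.trans hs.1.le, hs.2.le⟩, hlt.le⟩) hs.1.not_ge
    have hup : ‖x s‖ ≤ ε := by
      by_contra! hlt
      exact absurd (hqmin ⟨⟨hp₁.trans hs.1.le, hs.2.le.trans hqt⟩, hlt.le⟩) hs.2.not_ge
    have h1 : 1 ≤ g s / c₁ := (one_le_div hc₁).2 (hpos s has hlow)
    calc ‖F s‖ ≤ c * (1 + g s) := hgrowth s has hup
      _ ≤ |c| * (1 + g s) := by
          have := hg0 s has
          gcongr
          exact le_abs_self c
      _ ≤ |c| * (g s / c₁ + g s) := by gcongr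
      _ = K * g s := by rw [hK]; ring
  have hle : ‖x q - x p‖ ≤ ∫ s in p..q, K * g s := by
    rw [hF p q (hat₁.trans hp₁) hpq]
    refine intervalIntegral.norm_integral_le_of_norm_le hpq ?_
      ((hint p q (hat₁.trans hp₁) hpq).const_mul K)
    have hne : ∀ᵐ s : ℝ, s ≠ q := by simp [ae_iff, measure_singleton]
    filter_upwards [hne] with s hsq hs using hbound s ⟨hs.1, lt_of_le_of_ne hs.2 hsq⟩
  rw [intervalIntegral.integral_const_mul] at hle
  have h1 := hA p q (hAt₁.trans hp₁) hpq
  have h2 : K * ∫ s in p..q, g s ≤ K * η := by gcongr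
  have h3 : η * (K + 1) = ε / 2 := div_mul_cancel₀ _ (by positivity)
  have h4 := norm_sub_norm_le (x q) (x p)
  simp only [mem_preimage, mem_Ici, mem_Iic] at hqε hpε
  nlinarith

/-! ### Timing of the network -/

namespace Network

variable {N : Network} {T : ℝ}

theorem Valid.t_zero_le (hN : N.Valid T) (k : ℕ) : N.t 0 ≤ N.t k := by
  obtain ⟨δ, hδ, h⟩ := hN.sampling
  exact monotone_nat_of_le_succ (fun i => by linarith [(h i).1]) (Nat.zero_le k)

theorem Valid.t_le_arrival (hN : N.Valid T) (k : ℕ) : N.t k ≤ N.arrival k := by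
  have h1 := hN.uplink_nonneg k
  have h2 := hN.computation_nonneg
  have h3 := hN.downlink_nonneg
  simp only [arrival, τRTT]
  linarith

/-- Sampling times grow at least linearly and arrivals never precede them. Finiteness ensures that a
newest arrived trajectory exists. -/
theorem Valid.finite_arrival_lt (hN : N.Valid T) (S : ℝ) : {k | N.arrival k < S}.Finite := by
  obtain ⟨δ, hδ, h⟩ := hN.sampling
  have hlin : ∀ k : ℕ, N.t 0 + k * δ ≤ N.t k := by
    intro k
    induction k with
    | zero => simp
    | succ k ih =>
      push_cast
      linarith [(h k).1]
  obtain ⟨K, hK⟩ := exists_nat_gt ((S - N.t 0) / δ)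
  rw [div_lt_iff₀ hδ] at hK
  refine (finite_lt_nat K).subset fun k hk => ?_
  have h1 : (k : ℝ) * δ < K * δ := by
    linarith [hlin k, hN.t_le_arrival k, show N.arrival k < S from hk]
  exact_mod_cast lt_of_mul_lt_mul_right h1 hδ.le

end Network

/-! ### The closed loop follows the optimal trajectories -/

namespace Signals

variable {n m : ℕ} {σ : Signals n m} {N : Network} {P : ControlProblem n m}
  {W : EuclideanSpace ℝ (Fin n) → ℝ} {S r : ℝ} {k : ℕ}

/-- Acceptance orders the receptions at the controller; the computation and downlink delays are the
same for all packets, so the order persists at the actuator. -/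
theorem Accepted.arrival_le {j : ℕ} (hk : σ.Accepted N k) (hj : σ.Accepted N j) (hkj : k ≤ j) :
    N.arrival k ≤ N.arrival j := by
  rcases hkj.eq_or_lt with rfl | hlt
  · exact le_rfl
  · have h := hk.2 j hj.1 hlt
    simp only [Network.arrival, Network.τRTT, Network.received] at h ⊢
    linarith

theorem Plays.unique {B : Set ℕ} {s : ℝ} {v w : EuclideanSpace ℝ (Fin m)}
    (hv : σ.Plays N B s v) (hw : σ.Plays N B s w) : v = w := by
  rcases hv with ⟨hs, hv⟩ | ⟨hs, i, hi, -, hv⟩ <;> rcases hw with ⟨hs', hw⟩ | ⟨hs', j, hj, -, hw⟩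
  · rw [hv, hw]
  · exact absurd hs hs'.not_gt
  · exact absurd hs' hs.not_gt
  · rw [hv, hw, le_antisymm (hj.2.2 i hi.1 hi.2.1) (hi.2.2 j hj.1 hj.2.1)]

/-- Before its arrival, an accepted packet and its successors have no influence on the input. -/
theorem Plays.of_buffer {s : ℝ} {v : EuclideanSpace ℝ (Fin m)} (hk : σ.Accepted N k)
    (hs : s < N.arrival k) (hv : σ.Plays N {j | σ.Accepted N j ∧ j < k} s v) :
    σ.Plays N {j | σ.Accepted N j} s v := by
  refine hv.imp_right fun ⟨h0, j, hj, hlen, hval⟩ => ⟨h0, j, ⟨hj.1.1, hj.2.1, ?_⟩, hlen, hval⟩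
  refine fun i hi his => hj.2.2 i ⟨hi, ?_⟩ his
  by_contra! hki
  exact absurd (hk.arrival_le hi hki) (his.trans_lt hs).not_ge

namespace IsRunUntil

theorem input_mem (h : σ.IsRunUntil N P W P.X S) (hN : N.Valid P.T) {s : ℝ} (hs0 : N.t 0 ≤ s)
    (hsS : s < S) : σ.u s ∈ P.U := by
  rcases h.actuator s hs0 hsS with ⟨hs, hv⟩ | ⟨-, j, hj, hlen, hv⟩
  · exact hv ▸ h.uInit_mem s hs0 hs
  · rw [hv]
    exact (h.controller j hj.1 (hj.2.1.trans_lt hsS)).1.1.input_mem _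
      ⟨by linarith [hj.2.1], by linarith [hN.com_le]⟩

/-- In the nominal case the delay compensation of the controller is exact. -/
theorem xPred_arrival (h : σ.IsRunUntil N P W P.X S) (hP : P.Standing) (hN : N.Valid P.T)
    (hk : σ.Accepted N k) (hkS : N.arrival k < S) :
    σ.xPred k (N.arrival k) = σ.x (N.arrival k) := by
  obtain ⟨hinit, hsol⟩ := h.delay_compensation k hk hkS
  have ht0 := hN.t_zero_le k
  -- Until packet `k` arrives, the buffer and the actuator play the same trajectory, so prediction
  -- and plant solve the same initial value problem.
  have hu : EqOn (σ.uBuf k) σ.u (Ico (N.t k) (N.arrival k)) := fun s hs =>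
    ((h.buffer k hk hkS s hs.1 hs.2).of_buffer hk hs.2).unique
      (h.actuator s (ht0.trans hs.1) (hs.2.trans hkS))
  exact (hsol.congr hu fun _ _ => rfl).eqOn hP.lipschitz (h.plant.mono ht0 hkS.le) hinit
    (fun s hs => h.input_mem hN (ht0.trans hs.1) (hs.2.trans hkS))
    ⟨hN.t_le_arrival k, le_rfl⟩

/-- By `hlast` no newer accepted packet arrives strictly before `r`, so `k` is the active index. An
arrival at `r` itself is allowed, which lets `r` be the next arrival. -/
theorem input_eq (h : σ.IsRunUntil N P W P.X S) (hN : N.Valid P.T)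
    (hk : σ.Accepted N k) (hrS : r ≤ S)
    (hlast : ∀ i, σ.Accepted N i → N.arrival i < r → i ≤ k) {s : ℝ}
    (hs : s ∈ Ico (N.arrival k) r) :
    σ.u s = σ.uOpt k (s - N.arrival k) ∧ s ≤ N.arrival k + P.T := by
  have h0k := h.init_accepted.arrival_le hk (Nat.zero_le k)
  have ht0 := hN.t_le_arrival 0
  rcases h.actuator s (ht0.trans (h0k.trans hs.1)) (hs.2.trans_le hrS) with
    ⟨hlt, -⟩ | ⟨-, j, hj, hlen, hv⟩
  · exact absurd (h0k.trans hs.1) hlt.not_ge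
  · obtain rfl : j = k :=
      le_antisymm (hlast j hj.1 (hj.2.1.trans_lt hs.2)) (hj.2.2 k hk hs.1)
    exact ⟨hv, by linarith [hN.com_le]⟩

theorem le_arrival_add (h : σ.IsRunUntil N P W P.X S) (hP : P.Standing) (hN : N.Valid P.T)
    (hk : σ.Accepted N k) (hrS : r ≤ S)
    (hlast : ∀ i, σ.Accepted N i → N.arrival i < r → i ≤ k) : r ≤ N.arrival k + P.T := by
  refine le_of_forall_lt_imp_le_of_dense fun s hs => ?_
  rcases lt_or_ge s (N.arrival k) with hsk | hsk
  · linarith [hP.horizon_pos]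
  · exact (h.input_eq hN hk hrS hlast ⟨hsk, hs⟩).2

/-- While the trajectory computed from packet `k` is the newest one, the plant follows it. -/
theorem state_eq (h : σ.IsRunUntil N P W P.X S) (hP : P.Standing) (hN : N.Valid P.T)
    (hk : σ.Accepted N k) (hkS : N.arrival k < S) (hrS : r ≤ S)
    (hlast : ∀ i, σ.Accepted N i → N.arrival i < r → i ≤ k) :
    EqOn σ.x (fun s => σ.xOpt k (s - N.arrival k)) (Icc (N.arrival k) r) := by
  have hadm := (h.controller k hk hkS).1.1
  have hr := h.le_arrival_add hP hN hk hrS hlast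
  have ht0 := (hN.t_zero_le k).trans (hN.t_le_arrival k)
  have hsol := hadm.solution.comp_add_right (-N.arrival k)
  simp only [sub_neg_eq_add, zero_add, ← sub_eq_add_neg] at hsol
  have hsol' : IsSolution P.f σ.u (fun s => σ.xOpt k (s - N.arrival k)) (N.arrival k) r :=
    (hsol.mono le_rfl (by linarith)).congr
      (fun s hs => (h.input_eq hN hk hrS hlast hs).1.symm) fun _ _ => rfl
  refine (h.plant.mono ht0 hrS).eqOn hP.lipschitz hsol' ?_
    fun s hs => h.input_mem hN (ht0.trans hs.1) (hs.2.trans_le hrS)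
  rw [sub_self, hadm.initial, h.xPred_arrival hP hN hk hkS]

end IsRunUntil

/-- The cost incurred between the start of the closed loop and time `r`, plus the objective of
some feasible pair for the state at time `r`, is at most `M`. -/
def HasCostLE (σ : Signals n m) (N : Network) (P : ControlProblem n m)
    (W : EuclideanSpace ℝ (Fin n) → ℝ) (M r : ℝ) : Prop :=
  IntervalIntegrable (fun t => P.ℓ (σ.x t) (σ.u t)) volume (N.arrival 0) r ∧
    0 ≤ (∫ t in (N.arrival 0)..r, P.ℓ (σ.x t) (σ.u t)) ∧
    ∃ u x, P.IsFeasible P.X (σ.x r) u x ∧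
      P.cost W u x + ∫ t in (N.arrival 0)..r, P.ℓ (σ.x t) (σ.u t) ≤ M

variable {β γ M : ℝ}

namespace IsRunUntil

theorem hasCostLE_of_arrival (h : σ.IsRunUntil N P (fun x => β * P.Vf x) P.X S)
    (hP : P.Standing) (hN : N.Valid P.T) (hterm : P.TerminalConditions (P.terminalRegion γ))
    (hβ : 1 ≤ β) (hM : M ≤ β * γ)
    (hk : σ.Accepted N k) (hkS : N.arrival k < S)
    (hcost : σ.HasCostLE N P (fun x => β * P.Vf x) M (N.arrival k))
    (hkr : N.arrival k ≤ r) (hrS : r ≤ S)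
    (hlast : ∀ i, σ.Accepted N i → N.arrival i < r → i ≤ k) :
    σ.HasCostLE N P (fun x => β * P.Vf x) M r := by
  obtain ⟨hint, hnn, u₀, x₀, hfeas₀, hle₀⟩ := hcost
  obtain ⟨hfeas, hopt⟩ := h.controller k hk hkS
  rw [h.xPred_arrival hP hN hk hkS] at hfeas hopt
  have hT : P.T ∈ Icc 0 P.T := ⟨hP.horizon_pos.le, le_rfl⟩
  have hcostk := hopt u₀ x₀ hfeas₀
  have hr := h.le_arrival_add hP hN hk hrS hlast
  have hd : r - N.arrival k ∈ Icc 0 P.T := ⟨by linarith, by linarith⟩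
  -- The implicit terminal constraint: the optimal objective is at most `M ≤ β * γ`, and its running
  -- cost is nonnegative, as is the cost already incurred.
  have hVf : P.Vf (σ.xOpt k P.T) ≤ γ := by
    have h1 := hfeas.1.integral_cost_nonneg hP le_rfl hT.1 le_rfl
    refine le_of_mul_le_mul_left ?_ (zero_lt_one.trans_le hβ)
    simp only [ControlProblem.cost] at hcostk hle₀
    linarith
  have hx := h.state_eq hP hN hk hkS hrS hlast
  obtain ⟨u', x', hfeas', hle'⟩ := ControlProblem.IsFeasible.exists_shift hterm hP
    (⟨hfeas.1, hfeas.2, hVf⟩ : P.IsFeasible (P.terminalRegion γ) _ _ _) hβ hd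
  have heq : EqOn (fun s => P.ℓ (σ.xOpt k (s - N.arrival k)) (σ.uOpt k (s - N.arrival k)))
      (fun s => P.ℓ (σ.x s) (σ.u s)) (Ioo (N.arrival k) r) := fun s hs => by
    simp only [hx (Ioo_subset_Icc_self hs),
      (h.input_eq hN hk hrS hlast (Ioo_subset_Ico_self hs)).1]
  have hintk : IntervalIntegrable (fun s => P.ℓ (σ.x s) (σ.u s)) volume (N.arrival k) r := by
    have h1 := (hfeas.1.intervalIntegrable_cost le_rfl hd.1 hd.2).comp_sub_right (N.arrival k)
    rw [zero_add, sub_add_cancel, intervalIntegrable_iff_integrableOn_Ioo_of_le hkr] at h1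
    rw [intervalIntegrable_iff_integrableOn_Ioo_of_le hkr]
    exact h1.congr_fun heq measurableSet_Ioo
  have hval : ∫ s in (N.arrival k)..r, P.ℓ (σ.x s) (σ.u s) =
      ∫ s in (0 : ℝ)..(r - N.arrival k), P.ℓ (σ.xOpt k s) (σ.uOpt k s) := by
    have h1 := intervalIntegral.integral_comp_sub_right (a := N.arrival k) (b := r)
      (fun s => P.ℓ (σ.xOpt k s) (σ.uOpt k s)) (N.arrival k)
    rw [sub_self] at h1
    rw [← h1, intervalIntegral.integral_of_le hkr, intervalIntegral.integral_of_le hkr,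
      integral_Ioc_eq_integral_Ioo, integral_Ioc_eq_integral_Ioo]
    exact setIntegral_congr_fun measurableSet_Ioo heq.symm
  have hnnk := hfeas.1.integral_cost_nonneg hP le_rfl hd.1 hd.2
  have hsplit := intervalIntegral.integral_add_adjacent_intervals hint hintk
  refine ⟨hint.trans hintk, by linarith, u', x', ?_, by linarith⟩
  rw [hx ⟨hkr, le_rfl⟩]
  exact hfeas'

theorem hasCostLE (h : σ.IsRunUntil N P (fun x => β * P.Vf x) P.X S)
    (hP : P.Standing) (hN : N.Valid P.T) (hterm : P.TerminalConditions (P.terminalRegion γ))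
    (hβ : 1 ≤ β) (hM : M ≤ β * γ) (hS : N.arrival 0 ≤ S)
    (hinit : σ.HasCostLE N P (fun x => β * P.Vf x) M (N.arrival 0)) :
    σ.HasCostLE N P (fun x => β * P.Vf x) M S := by
  rcases hS.eq_or_lt with rfl | hS
  · exact hinit
  have harr : ∀ k, σ.Accepted N k → N.arrival k < S →
      σ.HasCostLE N P (fun x => β * P.Vf x) M (N.arrival k) := by
    intro k
    induction k using Nat.strong_induction_on with
    | _ k ih =>
      intro hk hkS
      rcases Nat.eq_zero_or_pos k with rfl | hpos
      · exact hinit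
      -- `j` is the accepted packet preceding `k`. Accepted packets with index at least `k` arrive
      -- no earlier than `k`, so `j` remains the newest until then.
      obtain ⟨j, ⟨hj, hjk⟩, hmax⟩ := exists_max_image {i | σ.Accepted N i ∧ i < k} id
        ((finite_lt_nat k).subset fun i hi => hi.2) ⟨0, h.init_accepted, hpos⟩
      have hjk' := hj.arrival_le hk hjk.le
      refine h.hasCostLE_of_arrival hP hN hterm hβ hM hj (hjk'.trans_lt hkS)
        (ih j hjk hj (hjk'.trans_lt hkS)) hjk' hkS.le fun i hi hik => hmax i ⟨hi, ?_⟩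
      by_contra! hki
      exact absurd (hk.arrival_le hi hki) hik.not_ge
  obtain ⟨j, ⟨hj, hjS⟩, hmax⟩ := exists_max_image {i | σ.Accepted N i ∧ N.arrival i < S} id
    ((hN.finite_arrival_lt S).subset fun i hi => hi.2) ⟨0, h.init_accepted, hS⟩
  exact h.hasCostLE_of_arrival hP hN hterm hβ hM hj hjS (harr j hj hjS) (le_of_lt hjS) le_rfl
    fun i hi hiS => hmax i ⟨hi, hiS⟩

end IsRunUntil

/-- A run that is defined for all times and has bounded cost converges to the origin. -/
theorem tendsto_norm_zero_of_hasCostLE (hP : P.Standing) (hN : N.Valid P.T)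
    (hW : ∀ x ∈ P.X, 0 ≤ W x) (h : ∀ S, σ.IsRunUntil N P W P.X S)
    (hcost : ∀ S, N.arrival 0 ≤ S → σ.HasCostLE N P W M S) :
    Tendsto (fun t => ‖σ.x t‖) atTop (𝓝 0) := by
  have ht0 := hN.t_le_arrival 0
  have hT : P.T ∈ Icc 0 P.T := ⟨hP.horizon_pos.le, le_rfl⟩
  -- A run until `S` prescribes the input only strictly before `S`; hence the horizon `s + 1`.
  have huU : ∀ s, N.arrival 0 ≤ s → σ.u s ∈ P.U := fun s hs =>
    (h (s + 1)).input_mem hN (ht0.trans hs) (by linarith)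
  have hxX : ∀ s, N.arrival 0 ≤ s → σ.x s ∈ P.X := fun s hs => by
    obtain ⟨-, -, u, x, hfeas, -⟩ := hcost s hs
    exact hfeas.1.initial ▸ hfeas.1.state_mem 0 ⟨le_rfl, hT.1⟩
  have hg0 : ∀ s, N.arrival 0 ≤ s → 0 ≤ P.ℓ (σ.x s) (σ.u s) := fun s hs =>
    hP.cost_nonneg _ (hxX s hs) _ (huU s hs)
  refine tendsto_norm_zero_of_integrableOn_cost (a := N.arrival 0)
    (F := fun s => P.f (σ.x s) (σ.u s)) (g := fun s => P.ℓ (σ.x s) (σ.u s)) ?_ ?_ ?_ hg0 ?_ ?_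
  · intro s hs
    have h1 := (h (s + 1)).plant.continuousOn s ⟨ht0.trans hs, by linarith⟩
    refine h1.mono_of_mem_nhdsWithin ?_
    filter_upwards [self_mem_nhdsWithin, mem_nhdsWithin_of_mem_nhds (Iic_mem_nhds (lt_add_one s))]
      with t ht ht' using ⟨ht0.trans ht, ht'⟩
  · exact fun s t hs hst => (h t).plant.sub_eq_integral (ht0.trans hs) hst le_rfl
  · refine integrableOn_Ioi_of_intervalIntegral_norm_bounded (l := atTop) (b := id) M _
      (fun S => ?_) tendsto_id ?_
    · rcases le_or_gt (N.arrival 0) S with hS | hS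
      · exact (intervalIntegrable_iff_integrableOn_Ioc_of_le hS).1 (hcost S hS).1
      · rw [id, Ioc_eq_empty hS.le.not_gt]
        exact integrableOn_empty
    · filter_upwards [eventually_ge_atTop (N.arrival 0)] with S hS
      obtain ⟨-, -, u, x, hfeas, hle⟩ := hcost S hS
      have h1 := hfeas.1.integral_cost_nonneg hP le_rfl hT.1 le_rfl
      have h2 := hW _ (hfeas.1.state_mem _ hT)
      have h3 : ∫ t in (N.arrival 0)..S, ‖P.ℓ (σ.x t) (σ.u t)‖ =
          ∫ t in (N.arrival 0)..S, P.ℓ (σ.x t) (σ.u t) := by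
        refine intervalIntegral.integral_congr fun t ht => ?_
        rw [uIcc_of_le hS] at ht
        exact Real.norm_of_nonneg (hg0 t ht.1)
      simp only [ControlProblem.cost] at hle
      rw [id, h3]
      linarith
  · intro R
    obtain ⟨c, hc⟩ := hP.growth R
    exact ⟨c, fun t ht hR => hc _ (huU t ht) _ (hxX t ht) hR⟩
  · intro r hr
    obtain ⟨c, hc, hle⟩ := hP.cost_pos r hr
    exact ⟨c, hc, fun t ht hr' => hle _ (hxX t ht) hr' _ (huU t ht)⟩

end Signals

/-! ### The stability theorem -/

theorem theorem2 {n m : ℕ} (P : ControlProblem n m) (hP : P.Standing)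
    (γ : ℝ) (hγ : 0 < γ) (hterm : P.TerminalConditions (P.terminalRegion γ))
    (z : EuclideanSpace ℝ (Fin n))
    (hreach : ∃ s : ℝ, 0 ≤ s ∧ P.ReachesOrigin z s ∧
      (s ≤ P.T ∨ ∃ u x, P.IsFeasible (P.terminalRegion γ) z u x ∧ P.Vf (x P.T) < γ)) :
    ∃ β₀ : ℝ, 0 < β₀ ∧ ∀ β : ℝ, β₀ ≤ β →
      ∀ N : Network, N.Valid P.T → ∀ σ : Signals n m, σ.x (N.arrival 0) = z →
        (∀ S : ℝ, N.arrival 0 ≤ S → σ.IsRunUntil N P (fun x => β * P.Vf x) P.X S →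
          ∃ u x, P.IsFeasible P.X (σ.x S) u x) ∧
        ((∀ S : ℝ, σ.IsRunUntil N P (fun x => β * P.Vf x) P.X S) →
          Tendsto (fun t => ‖σ.x t‖) atTop (𝓝 0)) := by
  obtain ⟨u, x, hfeas, hlt⟩ :
      ∃ u x, P.IsFeasible (P.terminalRegion γ) z u x ∧ P.Vf (x P.T) < γ := by
    obtain ⟨s, hs, hs0, hsT | hex⟩ := hreach
    · obtain ⟨u, x, hfeas, hle⟩ := hs0.exists_isFeasible hterm hP hs hsT
      exact ⟨u, x, hfeas, hle.trans_lt hγ⟩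
    · exact hex
  have hgap : 0 < γ - P.Vf (x P.T) := sub_pos.2 hlt
  -- The quotient is the least `β` with `∫ ℓ + β * Vf (x T) ≤ β * γ`; the bound `1` is what the
  -- shifted pair requires.
  refine ⟨max 1 ((∫ t in (0 : ℝ)..P.T, P.ℓ (x t) (u t)) / (γ - P.Vf (x P.T))),
    zero_lt_one.trans_le (le_max_left _ _), fun β hβ N hN σ hσ => ?_⟩
  have hβ₁ : 1 ≤ β := (le_max_left _ _).trans hβ
  have hM : P.cost (fun x => β * P.Vf x) u x ≤ β * γ := by
    have h := (le_max_right _ _).trans hβ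
    rw [div_le_iff₀ hgap] at h
    simp only [ControlProblem.cost]
    linarith
  have hinit : σ.HasCostLE N P (fun x => β * P.Vf x) (P.cost (fun x => β * P.Vf x) u x)
      (N.arrival 0) := by
    refine ⟨IntervalIntegrable.refl, by simp, u, x, ⟨?_, hfeas.2.1⟩, by simp⟩
    rw [hσ]
    exact hfeas.1
  refine ⟨fun S hS hrun => ?_, fun hrun => ?_⟩
  · obtain ⟨-, -, u', x', hfeas', -⟩ := hrun.hasCostLE hP hN hterm hβ₁ hM hS hinit
    exact ⟨u', x', hfeas'⟩
  · exact Signals.tendsto_norm_zero_of_hasCostLE hP hN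
      (fun y hy => mul_nonneg (zero_le_one.trans hβ₁) (hP.penalty_nonneg y hy)) hrun
      fun S hS => (hrun S).hasCostLE hP hN hterm hβ₁ hM hS hinit
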